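/- Theorem 1.3. Let $\mathbb D\subset\mathbb C$ be the open unit disk. For a bounded Jordan domain $\mathbb Y\subset\mathbb C$ (a bounded, connected open set whose boundary is a Jordan curve) and $x,y\in\overline{\mathbb Y}$, let $d_{\mathbb Y}(x,y)\in[0,\infty]$ be the internal distance: the infimum of the lengths of all rectifiable curves in $\overline{\mathbb Y}$ that connect $x$ to $y$ (with $\inf\emptyset=\infty$). There exist a bounded Jordan domain $\mathbb Y$ and a homeomorphism $h$ of $\overline{\mathbb D}$ onto $\overline{\mathbb Y}$, belonging to the Sobolev class $\mathscr W^{1,1}(\mathbb D,\mathbb C)$ (that is, $h\in L^1(\mathbb D)$ with weak first derivatives in $L^1(\mathbb D)$), whose restriction $\varphi=h|_{\partial\mathbb D}$, which maps $\partial\mathbb D$ onto $\partial\mathbb Y$, does not satisfy the internal Douglas condition for $p=1$: $$\int_{\partial\mathbb D}\int_{\partial\mathbb D}\frac{d_{\mathbb Y}(\varphi(x),\varphi(y))}{|x-y|}\,dx\,dy=\infty ,$$ where $dx$ and $dy$ denote arc length. Thus, for $p=1$, the internal Douglas condition is not necessary for a homeomorphism $\partial\mathbb D\to\partial\mathbb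 Y$ to have a homeomorphic extension $\overline{\mathbb D}\to\overline{\mathbb Y}$ in $\mathscr W^{1,1}(\mathbb D,\mathbb C)$. -/

import Mathlib

open MeasureTheory Set Metric
open scoped ENNReal ContDiff

/-- A bounded Jordan domain in the plane: a bounded, (nonempty) connected open set whose boundary
is a Jordan curve, i.e. the image of the unit circle under an injective continuous map. -/
def IsJordanDomain (Y : Set ℂ) : Prop :=
  IsOpen Y ∧ IsConnected Y ∧ Bornology.IsBounded Y ∧
    ∃ γ : Circle → ℂ, Continuous γ ∧ Function.Injective γ ∧ range γ = frontier Y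

/-- `h` restricts to a homeomorphism from `A` onto `B`. -/
def IsHomeomorphOn (h : ℂ → ℂ) (A B : Set ℂ) : Prop :=
  ∃ e : A ≃ₜ B, ∀ z : A, h z = e z

/-- `g` is a weak (distributional) derivative of `f` on the open set `Ω`: for every real-valued
test function `η ∈ C_c^∞(Ω)` and every direction `v`, `∫_Ω (∂_v η) f = - ∫_Ω η (g v)`. -/
def IsWeakDeriv (Ω : Set ℂ) (f : ℂ → ℂ) (g : ℂ → ℂ →L[ℝ] ℂ) : Prop :=
  ∀ η : ℂ → ℝ, ContDiff ℝ ∞ η → HasCompactSupport η → tsupport η ⊆ Ω →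
    ∀ v : ℂ, ∫ z in Ω, (fderiv ℝ η z v) • f z = - ∫ z in Ω, η z • g z v

/-- The Sobolev class `W^{1,p}(Ω, ℂ)` for `1 ≤ p ≤ ∞`: functions in `L^p(Ω)` having a weak
derivative in `L^p(Ω)`. The values of `f` outside `Ω` are irrelevant. -/
def MemSobolev (p : ℝ≥0∞) (Ω : Set ℂ) (f : ℂ → ℂ) : Prop :=
  MemLp f p (volume.restrict Ω) ∧
    ∃ g : ℂ → ℂ →L[ℝ] ℂ, MemLp g p (volume.restrict Ω) ∧ IsWeakDeriv Ω f g

/-- The internal distance of `Y`: the infimum of the lengths of curves in the closure of `Y` from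
`x` to `y`. The length is the total variation; non-rectifiable curves have length `∞` and so do
not influence the infimum, which is `∞` if there is no rectifiable curve. -/
noncomputable def internalDist (Y : Set ℂ) (x y : ℂ) : ℝ≥0∞ :=
  ⨅ (γ : Path x y) (_ : ∀ t, γ t ∈ closure Y), eVariationOn γ univ

/-- The internal `p`-Douglas condition for a boundary map `φ` of the unit circle into the boundary
of `Y`. The circle is parametrized by arc length, `t ↦ exp (i t)` on `(0, 2π]`; only the values of
`φ` on the unit circle matter. -/
def InternalDouglas (p : ℝ) (Y : Set ℂ) (φ : ℂ → ℂ) : Prop :=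
  ∫⁻ s in Ioc 0 (2 * Real.pi), ∫⁻ t in Ioc 0 (2 * Real.pi),
    internalDist Y (φ (circleMap 0 1 s)) (φ (circleMap 0 1 t)) ^ p /
      edist (circleMap 0 1 s) (circleMap 0 1 t) ^ p < ⊤

/-! Put `h z = ρ z • z` with `ρ = 1 + ∑ 2⁻ⁿ r^(2k)(1 + cos 2kθ)`, `k = 2^(4^n)`. As `ρ ≥ 1` is
continuous and nondecreasing along rays, `h` is a homeomorphism and its image of the disc is a
starlike Jordan domain. The gradient of `r^(2k)(1 + cos 2kθ)` is at most `4k r^(2k-1)`, whose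
integral over the disc is bounded uniformly in `k`. The weights `2⁻ⁿ` thus give convergence in
W^{1,1} (`memSobolev_lacunary`). The internal distance dominates the difference of moduli `|F s - F
t|`, where `F` is `ρ` on the circle. Testing `F s - F (s + τ)` against `cos Ns`, `N = 2k`, bounds
the Douglas integral below by `∫ π 2⁻ⁿ (1 - cos Nτ)/τ dτ ≥ π 2⁻ⁿ (log N - 1)`
(`ofReal_le_internalDouglas_integral`). Since `log N ≥ 4ⁿ log 2`, this is unbounded in `n`. -/

open Filter Topology

/-! ### Radial homeomorphisms and Jordan domains -/

/-- A continuous radial rescaling `z ↦ ρ z • z` of the plane, with `ρ ≥ 1` nondecreasing along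
rays, is a homeomorphism. -/
theorem exists_homeomorph_smul_of_radially_mono {ρ : ℂ → ℝ} (hc : Continuous ρ)
    (h1 : ∀ z, 1 ≤ ρ z) (hm : ∀ z (c : ℝ), 0 ≤ c → c ≤ 1 → ρ (c • z) ≤ ρ z) :
    ∃ e : ℂ ≃ₜ ℂ, ∀ z, e z = ρ z • z := by
  have hpos : ∀ z, 0 < ρ z := fun z => one_pos.trans_le (h1 z)
  have hcont : Continuous fun z => ρ z • z := hc.smul continuous_id
  -- Here `z = c • w` with `c = ρ w / ρ z ≤ 1`; monotonicity along the ray gives `ρ z ≤ ρ w`, so `c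
  -- = 1`.
  have hle : ∀ z w, ρ z • z = ρ w • w → ‖z‖ ≤ ‖w‖ → z = w := by
    intro z w h hzw
    have hz : z = (ρ w / ρ z) • w := by
      rw [div_eq_inv_mul, mul_smul, ← h, smul_smul, inv_mul_cancel₀ (hpos z).ne', one_smul]
    rcases eq_or_ne w 0 with rfl | hw
    · simpa using hz
    have hc0 : 0 ≤ ρ w / ρ z := (div_pos (hpos w) (hpos z)).le
    have hc1 : ρ w / ρ z ≤ 1 := by
      rw [hz, norm_smul, Real.norm_of_nonneg hc0] at hzw
      exact le_of_mul_le_mul_right (by simpa using hzw) (norm_pos_iff.2 hw)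
    have := hm w _ hc0 hc1
    rw [← hz] at this
    have h2 : ρ w / ρ z = 1 := le_antisymm hc1 ((one_le_div (hpos z)).2 this)
    rw [hz, h2, one_smul]
  have hinj : Function.Injective fun z => ρ z • z := by
    intro z w h
    rcases le_total ‖z‖ ‖w‖ with h' | h'
    · exact hle z w h h'
    · exact (hle w z h.symm h').symm
  have hsurj : Function.Surjective fun z => ρ z • z := by
    intro w
    have hφ : ContinuousOn (fun r : ℝ => r * ρ (r • w)) (Icc 0 1) := by fun_prop
    have := intermediate_value_Icc zero_le_one hφ (show (1 : ℝ) ∈ _ by simpa using h1 w)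
    obtain ⟨r, -, hr⟩ := this
    refine ⟨r • w, ?_⟩
    simp only at hr ⊢
    rw [smul_smul, mul_comm, hr, one_smul]
  -- The map does not decrease norms, hence is proper.
  have hclosed : IsClosedMap fun z => ρ z • z := by
    refine (isProperMap_iff_tendsto_cocompact.2 ⟨hcont, ?_⟩).isClosedMap
    rw [← cobounded_eq_cocompact, ← tendsto_norm_atTop_iff_cobounded]
    refine tendsto_atTop_mono (fun z => ?_) tendsto_norm_cobounded_atTop
    rw [norm_smul, Real.norm_of_nonneg (hpos z).le]
    exact le_mul_of_one_le_left (norm_nonneg z) (h1 z)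
  exact ⟨(Equiv.ofBijective _ ⟨hinj, hsurj⟩).toHomeomorphOfContinuousClosed hcont hclosed,
    fun z => rfl⟩

/-- A homeomorphism of the whole plane commutes with closure and frontier, which is why the profile
is also extended outside the disc. -/
theorem Homeomorph.isJordanDomain_image_ball (e : ℂ ≃ₜ ℂ) : IsJordanDomain (e '' ball 0 1) := by
  refine ⟨e.isOpenMap _ isOpen_ball, ?_, ?_, fun u => e u, by fun_prop,
    e.injective.comp Subtype.val_injective, ?_⟩
  · exact (((convex_ball (0 : ℂ) 1).isConnected ⟨0, by simp⟩)).image _ e.continuous.continuousOn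
  · exact (((isCompact_closedBall (0 : ℂ) 1).image e.continuous).isBounded).subset
      (image_mono ball_subset_closedBall)
  · rw [← e.image_frontier, frontier_ball _ one_ne_zero]
    ext w
    simp only [mem_range, mem_image, mem_sphere_iff_norm, sub_zero]
    exact ⟨fun ⟨u, hu⟩ => ⟨u, Circle.norm_coe u, hu⟩,
      fun ⟨z, hz, hw⟩ => ⟨⟨z, mem_sphere_zero_iff_norm.2 hz⟩, hw⟩⟩

theorem Homeomorph.isHomeomorphOn_closedBall (e : ℂ ≃ₜ ℂ) :
    IsHomeomorphOn e (closedBall 0 1) (closure (e '' ball 0 1)) := by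
  rw [← e.image_closure, closure_ball _ one_ne_zero]
  exact ⟨e.image _, fun _ => rfl⟩

/-! ### The lacunary profile -/

/-- The radial retraction of the plane onto the closed unit disc. -/
noncomputable def discRetraction (z : ℂ) : ℂ := (max 1 ‖z‖)⁻¹ • z

theorem continuous_discRetraction : Continuous discRetraction := by
  unfold discRetraction
  exact (Continuous.inv₀ (continuous_const.max continuous_norm) fun z => (lt_max_of_lt_left one_pos).ne').smul continuous_id

theorem norm_discRetraction_le (z : ℂ) : ‖discRetraction z‖ ≤ 1 := by
  have h : 0 < max 1 ‖z‖ := lt_max_of_lt_left one_pos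
  rw [discRetraction, norm_smul, norm_inv, Real.norm_of_nonneg h.le, inv_mul_le_one₀ h]
  exact le_max_right _ _

theorem discRetraction_of_norm_le {z : ℂ} (hz : ‖z‖ ≤ 1) : discRetraction z = z := by
  simp [discRetraction, max_eq_left hz]

theorem exists_discRetraction_smul (z : ℂ) {c : ℝ} (h0 : 0 ≤ c) (h1 : c ≤ 1) :
    ∃ b : ℝ, 0 ≤ b ∧ b ≤ 1 ∧ discRetraction (c • z) = b • discRetraction z := by
  have h : 0 < max 1 ‖z‖ := lt_max_of_lt_left one_pos
  have h' : 0 < max 1 ‖c • z‖ := lt_max_of_lt_left one_pos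
  refine ⟨max 1 ‖z‖ * c / max 1 ‖c • z‖, by positivity, ?_, ?_⟩
  · rw [div_le_one h', max_mul_of_nonneg _ _ h0, norm_smul, Real.norm_of_nonneg h0]
    exact max_le (by simp [h1]) (by rw [mul_comm]; exact le_max_right _ _)
  · simp only [discRetraction, smul_smul]
    congr 1
    field_simp

/-- The radially nondecreasing oscillation `r ^ (2k) (1 + cos (2kθ))`. -/
noncomputable def radialWave (k : ℕ) (z : ℂ) : ℝ := (‖z‖ ^ 2) ^ k + (z ^ (2 * k)).re

theorem continuous_radialWave (k : ℕ) : Continuous (radialWave k) := by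
  unfold radialWave
  fun_prop

/-- The norm term serves this bound: a nonnegative function homogeneous of degree `2k` is
nondecreasing along rays, whereas `Re z^(2k)` alone is not. -/
theorem radialWave_nonneg (k : ℕ) (z : ℂ) : 0 ≤ radialWave k z := by
  have := (abs_le.1 (Complex.abs_re_le_norm (z ^ (2 * k)))).1
  rw [norm_pow, pow_mul] at this
  unfold radialWave
  linarith

theorem radialWave_smul (k : ℕ) (b : ℝ) (z : ℂ) :
    radialWave k (b • z) = b ^ (2 * k) * radialWave k z := by
  unfold radialWave
  rw [smul_pow, Complex.smul_re, norm_smul, mul_pow, mul_pow, ← pow_mul, Real.norm_eq_abs,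
    smul_eq_mul, (even_two_mul k).pow_abs]
  ring

theorem radialWave_smul_le (k : ℕ) {b : ℝ} (h0 : 0 ≤ b) (h1 : b ≤ 1) (z : ℂ) :
    radialWave k (b • z) ≤ radialWave k z := by
  rw [radialWave_smul]
  exact mul_le_of_le_one_left (radialWave_nonneg k z) (pow_le_one₀ h0 h1)

theorem radialWave_le_two (k : ℕ) {z : ℂ} (hz : ‖z‖ ≤ 1) : radialWave k z ≤ 2 := by
  have h := Complex.re_le_norm (z ^ (2 * k))
  rw [norm_pow] at h
  have h1 : ‖z‖ ^ (2 * k) ≤ 1 := pow_le_one₀ (norm_nonneg z) hz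
  unfold radialWave
  rw [← pow_mul]
  linarith

theorem radialWave_circleMap (k : ℕ) (s : ℝ) :
    radialWave k (circleMap 0 1 s) = 1 + Real.cos ((2 * k : ℕ) * s) := by
  have : circleMap 0 1 s ^ (2 * k) = circleMap 0 1 ((2 * k : ℕ) * s) := by
    simp only [circleMap, zero_add, Complex.ofReal_one, one_mul, ← Complex.exp_nat_mul]
    push_cast
    ring_nf
  rw [radialWave, this]
  have h := Complex.exp_ofReal_mul_I_re ((2 * k : ℕ) * s)
  push_cast at h
  simp [circleMap, h]

/-- The lacunary frequencies `2 ^ 4 ^ n`. -/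
def lacunaryFreq (n : ℕ) : ℕ := 2 ^ 4 ^ n

/-- The lacunary radial profile of the domain, constant along rays outside the unit disc. -/
noncomputable def lacunaryProfile (z : ℂ) : ℝ :=
  1 + ∑' n, (1 / 2 : ℝ) ^ n * radialWave (lacunaryFreq n) (discRetraction z)

theorem norm_profile_term_le (n : ℕ) (z : ℂ) :
    ‖(1 / 2 : ℝ) ^ n * radialWave (lacunaryFreq n) (discRetraction z)‖ ≤ (1 / 2) ^ n * 2 := by
  rw [norm_mul, Real.norm_of_nonneg (by positivity : (0 : ℝ) ≤ (1 / 2) ^ n),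
    Real.norm_of_nonneg (radialWave_nonneg _ _)]
  gcongr
  exact radialWave_le_two _ (norm_discRetraction_le z)

theorem summable_profile_term (z : ℂ) :
    Summable fun n => (1 / 2 : ℝ) ^ n * radialWave (lacunaryFreq n) (discRetraction z) :=
  (summable_geometric_two.mul_right 2).of_norm_bounded fun n => norm_profile_term_le n z

theorem continuous_lacunaryProfile : Continuous lacunaryProfile :=
  continuous_const.add <| continuous_tsum
    (fun _ => continuous_const.mul ((continuous_radialWave _).comp continuous_discRetraction))
    (summable_geometric_two.mul_right 2) norm_profile_term_le

theorem one_le_lacunaryProfile (z : ℂ) : 1 ≤ lacunaryProfile z :=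
  le_add_of_nonneg_right <| tsum_nonneg fun _ =>
    mul_nonneg (by positivity) (radialWave_nonneg _ _)

theorem lacunaryProfile_smul_le (z : ℂ) (c : ℝ) (h0 : 0 ≤ c) (h1 : c ≤ 1) :
    lacunaryProfile (c • z) ≤ lacunaryProfile z := by
  obtain ⟨b, hb0, hb1, hb⟩ := exists_discRetraction_smul z h0 h1
  refine add_le_add_right ((summable_profile_term _).tsum_le_tsum (fun _ => ?_)
    (summable_profile_term _)) _
  rw [hb]
  gcongr
  exact radialWave_smul_le _ hb0 hb1 _

/-! ### Weak derivatives of series -/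

theorem integrable_tsum_of_summable_integral_norm {α E : Type*} [MeasurableSpace α]
    [NormedAddCommGroup E] [CompleteSpace E] {μ : Measure α} {F : ℕ → α → E}
    (hF : ∀ n, Integrable (F n) μ) (hs : Summable fun n => ∫ a, ‖F n a‖ ∂μ) :
    Integrable (fun a => ∑' n, F n a) μ ∧ ∀ᵐ a ∂μ, Summable fun n => F n a := by
  have hfin : ∫⁻ a, ∑' n, ‖F n a‖ₑ ∂μ < ⊤ := by
    rw [lintegral_tsum fun n => (hF n).1.enorm]
    simp_rw [← ofReal_integral_norm_eq_lintegral_enorm (hF _)]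
    exact hs.tsum_ofReal_lt_top
  have hae : ∀ᵐ a ∂μ, Summable fun n => F n a := by
    filter_upwards [ae_lt_top' (AEMeasurable.tsum fun n => (hF n).1.enorm) hfin.ne] with a ha
    refine Summable.of_norm ?_
    have := ENNReal.summable_toReal ha.ne
    simpa using this
  refine ⟨⟨?_, ?_⟩, hae⟩
  · refine aestronglyMeasurable_of_tendsto_ae atTop
      (f := fun N a => ∑ n ∈ Finset.range N, F n a) (fun N => ?_) ?_
    · exact Finset.aestronglyMeasurable_fun_sum _ fun n _ => (hF n).1
    · filter_upwards [hae] with a ha using ha.hasSum.tendsto_sum_nat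
  · exact (lintegral_mono fun a => enorm_tsum_le_tsum_enorm).trans_lt hfin

theorem isWeakDeriv_fderiv {Ω : Set ℂ} {f : ℂ → ℂ} (hf : ContDiff ℝ 1 f) :
    IsWeakDeriv Ω f (fderiv ℝ f) := by
  intro η hη hc hsub v
  have hη' : Continuous fun z => fderiv ℝ η z v :=
    (hη.continuous_fderiv (by simp)).clm_apply continuous_const
  have hf' : Continuous fun z => fderiv ℝ f z v :=
    (hf.continuous_fderiv one_ne_zero).clm_apply continuous_const
  have hc' : HasCompactSupport fun z => fderiv ℝ η z v := hc.fderiv_apply (𝕜 := ℝ) v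
  have hη0 : ∀ z, z ∉ Ω → η z = 0 := fun z hz =>
    image_eq_zero_of_notMem_tsupport fun h => hz (hsub h)
  have hη0' : ∀ z, z ∉ Ω → fderiv ℝ η z v = 0 := fun z hz => by
    rw [fderiv_of_notMem_tsupport ℝ (fun h => hz (hsub h))]
    simp
  -- Both integrands vanish off `Ω`, so the integration by parts takes place on the whole plane.
  rw [setIntegral_eq_integral_of_forall_compl_eq_zero fun z hz => by rw [hη0' z hz, zero_smul],
    setIntegral_eq_integral_of_forall_compl_eq_zero fun z hz => by rw [hη0 z hz, zero_smul],
    integral_smul_fderiv_eq_neg_fderiv_smul_of_integrable, neg_neg]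
  · exact (hη'.smul hf.continuous).integrable_of_hasCompactSupport hc'.smul_right
  · exact (hη.continuous.smul hf').integrable_of_hasCompactSupport hc.smul_right
  · exact (hη.continuous.smul hf.continuous).integrable_of_hasCompactSupport hc.smul_right
  · exact fun z _ => hη.differentiable (by simp) z
  · exact fun z _ => hf.differentiable one_ne_zero z

theorem summable_integral_norm_of_le {α E F : Type*} [MeasurableSpace α] [NormedAddCommGroup E]
    [NormedAddCommGroup F] {μ : Measure α} {f : ℕ → α → E} {g : ℕ → α → F} (C : ℝ)
    (hg : ∀ n, Integrable (g n) μ) (hs : Summable fun n => ∫ a, ‖g n a‖ ∂μ)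
    (hfg : ∀ n a, ‖f n a‖ ≤ C * ‖g n a‖) : Summable fun n => ∫ a, ‖f n a‖ ∂μ := by
  refine (hs.mul_left C).of_nonneg_of_le (fun n => integral_nonneg fun a => norm_nonneg _)
    fun n => ?_
  rw [← integral_const_mul]
  exact integral_mono_of_nonneg (.of_forall fun a => norm_nonneg _) ((hg n).norm.const_mul C)
    (.of_forall fun a => hfg n a)

/-- `η` and `∂_v η` are bounded, so L¹-summability passes to the pairings and sum and integral
commute on both sides. -/
theorem IsWeakDeriv.tsum {Ω : Set ℂ} {f : ℕ → ℂ → ℂ} {g : ℕ → ℂ → ℂ →L[ℝ] ℂ}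
    (h : ∀ n, IsWeakDeriv Ω (f n) (g n))
    (hf : ∀ n, IntegrableOn (f n) Ω) (hg : ∀ n, IntegrableOn (g n) Ω)
    (hfs : Summable fun n => ∫ z in Ω, ‖f n z‖) (hgs : Summable fun n => ∫ z in Ω, ‖g n z‖) :
    IsWeakDeriv Ω (fun z => ∑' n, f n z) (fun z => ∑' n, g n z) := by
  intro η hη hc hsub v
  have hη' : Continuous fun z => fderiv ℝ η z v :=
    (hη.continuous_fderiv (by simp)).clm_apply continuous_const
  obtain ⟨C, hC⟩ := hη.continuous.bounded_above_of_compact_support hc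
  obtain ⟨C', hC'⟩ := hη'.bounded_above_of_compact_support (hc.fderiv_apply (𝕜 := ℝ) v)
  have hgle : ∀ n z, ‖η z • g n z v‖ ≤ C * ‖v‖ * ‖g n z‖ := fun n z => by
    rw [norm_smul, mul_assoc, mul_comm ‖v‖]
    exact mul_le_mul (hC z) ((g n z).le_opNorm v) (norm_nonneg _) ((norm_nonneg _).trans (hC z))
  have hfle : ∀ n z, ‖fderiv ℝ η z v • f n z‖ ≤ C' * ‖f n z‖ := fun n z => by
    rw [norm_smul]
    exact mul_le_mul_of_nonneg_right (hC' z) (norm_nonneg _)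
  have hgi : ∀ n, Integrable (fun z => η z • g n z v) (volume.restrict Ω) := fun n =>
    ((hg n).norm.const_mul (C * ‖v‖)).mono'
      (hη.continuous.aestronglyMeasurable.smul ((hg n).1.apply_continuousLinearMap v))
      (.of_forall (hgle n))
  have hfi : ∀ n, Integrable (fun z => fderiv ℝ η z v • f n z) (volume.restrict Ω) := fun n =>
    ((hf n).norm.const_mul C').mono' (hη'.aestronglyMeasurable.smul (hf n).1) (.of_forall (hfle n))
  calc ∫ z in Ω, fderiv ℝ η z v • ∑' n, f n z
      = ∫ z in Ω, ∑' n, fderiv ℝ η z v • f n z := by simp_rw [tsum_const_smul'']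
    _ = ∑' n, ∫ z in Ω, fderiv ℝ η z v • f n z :=
      (integral_tsum_of_summable_integral_norm hfi
        (summable_integral_norm_of_le C' hf hfs hfle)).symm
    _ = - ∑' n, ∫ z in Ω, η z • g n z v := by
      rw [← tsum_neg]
      exact tsum_congr fun n => h n η hη hc hsub v
    _ = - ∫ z in Ω, ∑' n, η z • g n z v := by
      rw [integral_tsum_of_summable_integral_norm hgi
        (summable_integral_norm_of_le (C * ‖v‖) hg hgs hgle)]
    _ = - ∫ z in Ω, η z • (∑' n, g n z) v := by
      congr 1
      refine integral_congr_ae ?_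
      -- Evaluation at `v` enters the sum only where the series of operators converges, that is,
      -- almost everywhere.
      filter_upwards [(integrable_tsum_of_summable_integral_norm hg hgs).2] with z hz
      rw [tsum_const_smul'']
      congr 1
      exact ((ContinuousLinearMap.apply ℝ ℂ v).map_tsum hz).symm

theorem memSobolev_one_tsum {Ω : Set ℂ} {f : ℕ → ℂ → ℂ} (hf : ∀ n, ContDiff ℝ 1 (f n))
    (hfi : ∀ n, IntegrableOn (f n) Ω) (hgi : ∀ n, IntegrableOn (fderiv ℝ (f n)) Ω)
    (hfs : Summable fun n => ∫ z in Ω, ‖f n z‖)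
    (hgs : Summable fun n => ∫ z in Ω, ‖fderiv ℝ (f n) z‖) :
    MemSobolev 1 Ω fun z => ∑' n, f n z :=
  ⟨memLp_one_iff_integrable.2 (integrable_tsum_of_summable_integral_norm hfi hfs).1, _,
    memLp_one_iff_integrable.2 (integrable_tsum_of_summable_integral_norm hgi hgs).1,
    IsWeakDeriv.tsum (fun n => isWeakDeriv_fderiv (hf n)) hfi hgi hfs hgs⟩

/-! ### Sobolev bound for the lacunary series -/

theorem setIntegral_ball_norm_pow (m : ℕ) :
    ∫ z in ball (0 : ℂ) 1, ‖z‖ ^ m = 2 * Real.pi / (m + 2) := by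
  have h := integral_fun_norm_addHaar (volume : Measure ℂ) ((Iio 1).indicator fun r : ℝ => r ^ m)
  have hl : ∀ z : ℂ, (Iio 1).indicator (fun r : ℝ => r ^ m) ‖z‖
      = (ball 0 1).indicator (fun z : ℂ => ‖z‖ ^ m) z := fun z => by
    simp [indicator]
  have hr : ∀ y : ℝ, y ^ (Module.finrank ℝ ℂ - 1) • (Iio 1).indicator (fun r : ℝ => r ^ m) y
      = (Iio 1).indicator (fun r : ℝ => r ^ (m + 1)) y := fun y => by
    by_cases hy : y < 1 <;> simp [indicator, hy, Complex.finrank_real_complex, pow_succ']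
  simp_rw [hl, hr] at h
  rw [integral_indicator measurableSet_ball, setIntegral_indicator measurableSet_Iio,
    Ioi_inter_Iio, ← integral_Ioc_eq_integral_Ioo,
    ← intervalIntegral.integral_of_le zero_le_one, integral_pow] at h
  rw [h]
  simp [Complex.finrank_real_complex, measureReal_def, add_assoc, one_add_one_eq_two]
  ring

theorem contDiff_radialWave (k : ℕ) : ContDiff ℝ 1 (radialWave k) := by
  unfold radialWave
  exact ((contDiff_norm_sq ℝ).pow k).add
    (Complex.reCLM.contDiff.comp (contDiff_id.pow (2 * k)))

/-- Each of the two summands contributes `2k‖z‖^(2k-1)`. -/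
theorem norm_fderiv_radialWave_le {k : ℕ} (hk : k ≠ 0) (z : ℂ) :
    ‖fderiv ℝ (radialWave k) z‖ ≤ 4 * k * ‖z‖ ^ (2 * k - 1) := by
  have h1 := ((hasStrictFDerivAt_norm_sq z).hasFDerivAt).pow k
  have h2 := Complex.reCLM.hasFDerivAt.comp z
    (((hasDerivAt_pow (2 * k) z).hasFDerivAt).restrictScalars ℝ)
  have h := h1.add h2
  have he : fderiv ℝ (radialWave k) z = _ := h.fderiv
  rw [he]
  obtain ⟨j, rfl⟩ := Nat.exists_eq_succ_of_ne_zero hk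
  have hj : 2 * (j + 1) - 1 = 2 * j + 1 := by omega
  have hsq : (‖z‖ ^ 2) ^ j * ‖z‖ = ‖z‖ ^ (2 * j + 1) := by rw [← pow_mul, pow_succ]
  have e1 : ‖((j + 1) • (‖z‖ ^ 2) ^ (j + 1 - 1)) • 2 • innerSL ℝ z‖
      ≤ 2 * (j + 1 : ℕ) * ‖z‖ ^ (2 * j + 1) := by
    rw [norm_smul, nsmul_eq_mul, Real.norm_of_nonneg (by positivity), two_nsmul, ← two_smul ℝ,
      norm_smul, innerSL_apply_norm, Nat.add_sub_cancel, ← hsq, Real.norm_ofNat]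
    apply le_of_eq
    ring
  have e2 : ‖Complex.reCLM ∘SL ContinuousLinearMap.restrictScalars ℝ
      (ContinuousLinearMap.toSpanSingleton ℂ (((2 * (j + 1) : ℕ) : ℂ) * z ^ (2 * (j + 1) - 1)))‖
      ≤ 2 * (j + 1 : ℕ) * ‖z‖ ^ (2 * j + 1) := by
    refine (ContinuousLinearMap.opNorm_comp_le _ _).trans ?_
    rw [Complex.reCLM_norm, one_mul, ContinuousLinearMap.norm_restrictScalars,
      ContinuousLinearMap.norm_toSpanSingleton, norm_mul, norm_pow, hj, Complex.norm_natCast]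
    apply le_of_eq
    push_cast
    ring
  refine (norm_add_le_of_le e1 e2).trans_eq ?_
  rw [Nat.succ_eq_add_one, hj]
  ring

/-- The terms of a series for the lacunary homeomorphism on the disc. -/
noncomputable def radialTerm (n : ℕ) (z : ℂ) : ℂ :=
  ((1 / 2 : ℝ) ^ n * (radialWave (lacunaryFreq n) z + 1 / 2)) • z

theorem contDiff_radialTerm (n : ℕ) : ContDiff ℝ 1 (radialTerm n) := by
  unfold radialTerm
  exact (contDiff_const.mul ((contDiff_radialWave _).add contDiff_const)).smul contDiff_id

theorem norm_radialTerm_le (n : ℕ) {z : ℂ} (hz : ‖z‖ ≤ 1) :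
    ‖radialTerm n z‖ ≤ (1 / 2) ^ n * (5 / 2) := by
  have h0 := radialWave_nonneg (lacunaryFreq n) z
  have h2 := radialWave_le_two (lacunaryFreq n) hz
  rw [radialTerm, norm_smul, Real.norm_of_nonneg (by positivity)]
  refine (mul_le_of_le_one_right (by positivity) hz).trans ?_
  gcongr
  linarith

theorem norm_fderiv_radialTerm_le (n : ℕ) {z : ℂ} (hz : ‖z‖ ≤ 1) :
    ‖fderiv ℝ (radialTerm n) z‖
      ≤ (1 / 2) ^ n * (5 / 2 + 4 * lacunaryFreq n * ‖z‖ ^ (2 * lacunaryFreq n - 1)) := by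
  set k := lacunaryFreq n with hk
  have hk0 : k ≠ 0 := by simp [hk, lacunaryFreq]
  have h0 := radialWave_nonneg k z
  have h2 := radialWave_le_two k hz
  have hw := ((contDiff_radialWave k).differentiable one_ne_zero z).hasFDerivAt
  have h : HasFDerivAt (radialTerm n) _ z :=
    (((hw.add_const (1 / 2)).const_mul ((1 / 2 : ℝ) ^ n)).smul (hasFDerivAt_id z))
  rw [h.fderiv]
  refine (norm_add_le_of_le ?_ ?_).trans_eq (mul_add _ _ _).symm
  · rw [norm_smul, Real.norm_of_nonneg (by positivity), ContinuousLinearMap.norm_id, mul_one]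
    gcongr
    linarith
  · refine (ContinuousLinearMap.norm_smulRight_apply _ _).le.trans ?_
    rw [norm_smul, Real.norm_of_nonneg (by positivity)]
    refine (mul_le_of_le_one_right (by positivity) hz).trans ?_
    gcongr
    exact norm_fderiv_radialWave_le hk0 z

theorem memSobolev_lacunary :
    MemSobolev 1 (ball 0 1) fun z => ∑' n, radialTerm n z := by
  have hint : ∀ {E : Type} [NormedAddCommGroup E] {f : ℂ → E}, Continuous f →
      IntegrableOn f (ball 0 1) := fun hf =>
    (hf.continuousOn.integrableOn_compact (isCompact_closedBall 0 1)).mono_set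
      ball_subset_closedBall
  have hfd : ∀ n, Continuous (fderiv ℝ (radialTerm n)) := fun n =>
    (contDiff_radialTerm n).continuous_fderiv one_ne_zero
  refine memSobolev_one_tsum contDiff_radialTerm
    (fun n => hint (contDiff_radialTerm n).continuous) (fun n => hint (hfd n)) ?_ ?_
  · refine (summable_geometric_two.mul_right (5 / 2 * Real.pi)).of_nonneg_of_le
      (fun n => integral_nonneg fun _ => norm_nonneg _) fun n => ?_
    calc _ ≤ ∫ z in ball (0 : ℂ) 1, (1 / 2 : ℝ) ^ n * (5 / 2) :=
          setIntegral_mono_on (hint (contDiff_radialTerm n).continuous).norm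
            (hint continuous_const) measurableSet_ball
            fun z hz => norm_radialTerm_le n (mem_ball_zero_iff.1 hz).le
      _ = _ := by
        simp [measureReal_def]
        ring
  · refine (summable_geometric_two.mul_right (13 / 2 * Real.pi)).of_nonneg_of_le
      (fun n => integral_nonneg fun _ => norm_nonneg _) fun n => ?_
    set k := lacunaryFreq n with hk
    have hk0 : 0 < k := by simp [hk, lacunaryFreq]
    calc _ ≤ ∫ z in ball (0 : ℂ) 1, (1 / 2 : ℝ) ^ n * (5 / 2 + 4 * k * ‖z‖ ^ (2 * k - 1)) :=
          setIntegral_mono_on (hint (hfd n)).norm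
            (hint (by fun_prop)) measurableSet_ball
            fun z hz => norm_fderiv_radialTerm_le n (mem_ball_zero_iff.1 hz).le
      _ = (1 / 2 : ℝ) ^ n * (5 / 2 * Real.pi + 4 * k * (2 * Real.pi / (2 * k + 1))) := by
        rw [integral_const_mul, integral_add (hint continuous_const) (hint (by fun_prop)),
          integral_const_mul, setIntegral_ball_norm_pow, Nat.cast_sub (by omega)]
        simp [measureReal_def]
        ring
      _ ≤ _ := by
        gcongr
        -- The area integral `2π/(2k+1)` cancels the growth of the frequency; `13/2 = 5/2 + 4`.
        have : 4 * (k : ℝ) * (2 * Real.pi / (2 * k + 1)) ≤ 4 * Real.pi := by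
          rw [mul_div_assoc', div_le_iff₀ (by positivity)]
          nlinarith [Real.pi_pos]
        linarith

theorem tsum_radialTerm {z : ℂ} (hz : ‖z‖ ≤ 1) : ∑' n, radialTerm n z = lacunaryProfile z • z := by
  have hs := summable_profile_term z
  rw [discRetraction_of_norm_le hz] at hs
  -- The halves in `radialTerm` sum to the constant `1` of the profile.
  have hs2 : Summable fun n => (1 / 2 : ℝ) ^ n * (1 / 2) := summable_geometric_two.mul_right _
  simp only [radialTerm, lacunaryProfile, discRetraction_of_norm_le hz, mul_add]
  rw [(hs.add hs2).tsum_smul_const, hs.tsum_add hs2, tsum_mul_right, tsum_geometric_two]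
  congr 1
  ring

/-! ### Lower bound for the Douglas integral -/

theorem edist_le_internalDist (Y : Set ℂ) (x y : ℂ) : edist x y ≤ internalDist Y x y := by
  refine le_iInf₂ fun γ _ => ?_
  simpa using eVariationOn.edist_le γ (mem_univ 0) (mem_univ 1)

theorem integral_cos_int_mul_add {j : ℤ} (hj : j ≠ 0) (b : ℝ) :
    ∫ s in (0 : ℝ)..2 * Real.pi, Real.cos (j * s + b) = 0 := by
  rw [intervalIntegral.integral_comp_mul_add _ (Int.cast_ne_zero.2 hj), integral_cos,
    mul_zero, zero_add, add_comm _ b, Real.sin_add_int_mul_two_pi, sub_self, smul_zero]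

theorem integral_cos_mul_cos {M N : ℕ} (hN : N ≠ 0) (τ : ℝ) :
    ∫ s in (0 : ℝ)..2 * Real.pi, Real.cos (M * (s + τ)) * Real.cos (N * s)
      = if M = N then Real.pi * Real.cos (N * τ) else 0 := by
  have h : ∀ s : ℝ, Real.cos (M * (s + τ)) * Real.cos (N * s)
      = 2⁻¹ * (Real.cos (((M + N : ℕ) : ℤ) * s + M * τ)
        + Real.cos (((M : ℤ) - N : ℤ) * s + M * τ)) := fun s => by
    have := Real.two_mul_cos_mul_cos (M * (s + τ)) (N * s)
    push_cast
    rw [show (M + N : ℝ) * s + M * τ = M * (s + τ) + N * s by ring,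
      show (M - N : ℝ) * s + M * τ = M * (s + τ) - N * s by ring]
    linarith
  simp_rw [h]
  rw [intervalIntegral.integral_const_mul, intervalIntegral.integral_add
    (Continuous.intervalIntegrable (by fun_prop) _ _)
    (Continuous.intervalIntegrable (by fun_prop) _ _), integral_cos_int_mul_add (by omega)]
  split_ifs with hMN
  · subst hMN
    simp
    ring
  · rw [integral_cos_int_mul_add (by omega)]
    simp

theorem log_sub_one_le_integral {N : ℝ} (hN : 1 ≤ N) :
    Real.log N - 1 ≤ ∫ τ in N⁻¹..1, (1 - Real.cos (N * τ)) / τ := by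
  have hN0 : 0 < N := one_pos.trans_le hN
  have hle : N⁻¹ ≤ 1 := inv_le_one_of_one_le₀ hN
  have hpos : ∀ τ ∈ Icc N⁻¹ 1, 0 < τ := fun τ hτ => (inv_pos.2 hN0).trans_le hτ.1
  -- Subtracting the nonnegative term `(1 - sin Nτ)/(Nτ²)` gives an integrand with an elementary
  -- antiderivative, avoiding the cosine integral.
  have hd : ∀ τ ∈ uIcc N⁻¹ 1, HasDerivAt
      (fun τ => Real.log τ - Real.sin (N * τ) / (N * τ) + 1 / (N * τ))
      ((1 - Real.cos (N * τ)) / τ - (1 - Real.sin (N * τ)) / (N * τ ^ 2)) τ := by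
    intro τ hτ
    rw [uIcc_of_le hle] at hτ
    have h0 := hpos τ hτ
    have hm : HasDerivAt (fun τ => N * τ) N τ := by simpa using (hasDerivAt_id τ).const_mul N
    have h := ((Real.hasDerivAt_log h0.ne').sub (hm.sin.div hm (by positivity))).add
      ((hasDerivAt_const τ (1 : ℝ)).div hm (by positivity))
    refine h.congr_deriv ?_
    have := h0.ne'
    field_simp
    ring
  have hc : ContinuousOn (fun τ => (1 - Real.cos (N * τ)) / τ) (uIcc N⁻¹ 1) := by
    rw [uIcc_of_le hle]
    exact ContinuousOn.div (by fun_prop) (by fun_prop) fun τ hτ => (hpos τ hτ).ne'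
  have hc' : ContinuousOn (fun τ => (1 - Real.sin (N * τ)) / (N * τ ^ 2)) (uIcc N⁻¹ 1) := by
    rw [uIcc_of_le hle]
    refine ContinuousOn.div (by fun_prop) (by fun_prop) fun τ hτ => ?_
    have := hpos τ hτ
    positivity
  calc Real.log N - 1
      ≤ ∫ τ in N⁻¹..1, ((1 - Real.cos (N * τ)) / τ - (1 - Real.sin (N * τ)) / (N * τ ^ 2)) := by
        rw [intervalIntegral.integral_eq_sub_of_hasDerivAt hd
          (hc.intervalIntegrable.sub hc'.intervalIntegrable)]
        have h1 : Real.sin N / N ≤ 1 / N := by gcongr; exact Real.sin_le_one N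
        have h2 : Real.sin 1 ≥ 0 := Real.sin_nonneg_of_nonneg_of_le_pi one_pos.le
          (by linarith [Real.pi_gt_three])
        simp only [mul_inv_cancel₀ hN0.ne', Real.log_inv, Real.log_one, mul_one, div_one]
        linarith
    _ ≤ _ := by
        refine intervalIntegral.integral_mono_on hle
          (hc.intervalIntegrable.sub hc'.intervalIntegrable) hc.intervalIntegrable fun τ hτ => ?_
        have := hpos τ hτ
        have := Real.sin_le_one (N * τ)
        exact sub_le_self _ (div_nonneg (by linarith) (by positivity))

theorem Function.Periodic.setLIntegral_Ioc_comp_add_left {f : ℝ → ℝ≥0∞} {T : ℝ} (hT : 0 < T)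
    (hf : Function.Periodic f T) (s : ℝ) :
    ∫⁻ t in Ioc 0 T, f (s + t) = ∫⁻ t in Ioc 0 T, f t := by
  have : Fact (0 < T) := ⟨hT⟩
  have h0 := AddCircle.lintegral_preimage T 0 hf.lift
  have hs := AddCircle.lintegral_preimage T s hf.lift
  simp only [Function.Periodic.lift_coe, zero_add] at h0 hs
  rw [h0, ← hs]
  have := (measurePreserving_add_left (volume : Measure ℝ) s).setLIntegral_comp_preimage_emb
    (measurableEmbedding_addLeft s) f (Ioc s (s + T))
  simpa using this

/-- A Fourier coefficient of the modulus of the boundary map bounds the Douglas integral from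
below. -/
theorem ofReal_le_internalDouglas_integral {Y : Set ℂ} {φ : ℂ → ℂ} {F : ℝ → ℝ}
    (hF : Continuous F) (hφ : ∀ s, ‖φ (circleMap 0 1 s)‖ = F s) {A : ℝ} (hA : 0 ≤ A) {N : ℕ}
    (hN : 1 ≤ N) (hcoef : ∀ τ, ∫ s in (0 : ℝ)..2 * Real.pi, F (s + τ) * Real.cos (N * s)
      = A * Real.cos (N * τ)) :
    ENNReal.ofReal (A * (Real.log N - 1)) ≤
      ∫⁻ s in Ioc 0 (2 * Real.pi), ∫⁻ t in Ioc 0 (2 * Real.pi),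
        internalDist Y (φ (circleMap 0 1 s)) (φ (circleMap 0 1 t)) ^ (1 : ℝ) /
          edist (circleMap 0 1 s) (circleMap 0 1 t) ^ (1 : ℝ) := by
  have hN0 : (1 : ℝ) ≤ N := by exact_mod_cast hN
  have hNi : (N : ℝ)⁻¹ ≤ 1 := inv_le_one_of_one_le₀ hN0
  have hNp : (0 : ℝ) < (N : ℝ)⁻¹ := by positivity
  -- A chord is at most its arc.
  have hedist : ∀ s τ : ℝ, 0 ≤ τ →
      edist (circleMap 0 1 s) (circleMap 0 1 (s + τ)) ≤ ENNReal.ofReal τ := by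
    intro s τ hτ
    have := (lipschitzWith_circleMap 0 1).edist_le_mul s (s + τ)
    simpa [edist_dist, abs_of_nonneg hτ] using this
  have hmeas : Measurable (Function.uncurry fun s τ : ℝ =>
      ENNReal.ofReal (|F s - F (s + τ)| / τ)) := by
    have h1 : Measurable fun p : ℝ × ℝ => |F p.1 - F (p.1 + p.2)| :=
      Continuous.measurable (by fun_prop)
    exact (h1.div measurable_snd).ennreal_ofReal
  calc ENNReal.ofReal (A * (Real.log N - 1))
      ≤ ENNReal.ofReal (∫ τ in (N : ℝ)⁻¹..1, A * ((1 - Real.cos (N * τ)) / τ)) := by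
        rw [intervalIntegral.integral_const_mul]
        gcongr
        exact log_sub_one_le_integral hN0
    _ = ∫⁻ τ in Ioc (N : ℝ)⁻¹ 1, ENNReal.ofReal (A * ((1 - Real.cos (N * τ)) / τ)) := by
        rw [intervalIntegral.integral_of_le hNi, ofReal_integral_eq_lintegral_ofReal]
        · refine ContinuousOn.integrableOn_Icc ?_ |>.mono_set Ioc_subset_Icc_self
          refine continuousOn_const.mul (ContinuousOn.div (by fun_prop) (by fun_prop) ?_)
          exact fun τ hτ => (hNp.trans_le hτ.1).ne'
        · refine (ae_restrict_mem measurableSet_Ioc).mono fun τ hτ => ?_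
          have := Real.cos_le_one (N * τ)
          exact mul_nonneg hA (div_nonneg (by linarith) (hNp.trans hτ.1).le)
    _ ≤ ∫⁻ τ in Ioc (N : ℝ)⁻¹ 1, ∫⁻ s in Ioc 0 (2 * Real.pi),
          ENNReal.ofReal (|F s - F (s + τ)| / τ) := by
        refine setLIntegral_mono' measurableSet_Ioc fun τ hτ => ?_
        have hτ0 : 0 < τ := hNp.trans hτ.1
        have hint : ∀ {g : ℝ → ℝ}, Continuous g → IntervalIntegrable g volume 0 (2 * Real.pi) :=
          fun hg => hg.intervalIntegrable _ _
        rw [← ofReal_integral_eq_lintegral_ofReal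
          (Continuous.integrableOn_Ioc (by fun_prop))
          (.of_forall fun s => div_nonneg (abs_nonneg _) hτ0.le),
          ← intervalIntegral.integral_of_le Real.two_pi_pos.le]
        refine ENNReal.ofReal_le_ofReal ?_
        have h0 := hcoef 0
        simp only [add_zero, mul_zero, Real.cos_zero, mul_one] at h0
        -- The left side is the pairing of `(F s - F (s + τ)) / τ` with `cos Ns`, and `|cos| ≤ 1`.
        calc A * ((1 - Real.cos (N * τ)) / τ)
            = ∫ s in (0 : ℝ)..2 * Real.pi,
                (F s * Real.cos (N * s) - F (s + τ) * Real.cos (N * s)) / τ := by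
              rw [intervalIntegral.integral_div, intervalIntegral.integral_sub
                (hint (by fun_prop)) (hint (by fun_prop)), h0, hcoef]
              ring
          _ ≤ _ := by
              refine intervalIntegral.integral_mono Real.two_pi_pos.le (hint (by fun_prop))
                (hint (by fun_prop)) fun s => ?_
              dsimp only
              gcongr
              rw [← sub_mul]
              refine (le_abs_self _).trans ?_
              rw [abs_mul]
              exact mul_le_of_le_one_right (abs_nonneg _) (Real.abs_cos_le_one _)
    _ ≤ ∫⁻ τ in Ioc 0 (2 * Real.pi), ∫⁻ s in Ioc 0 (2 * Real.pi),
          ENNReal.ofReal (|F s - F (s + τ)| / τ) :=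
        lintegral_mono_set (Ioc_subset_Ioc hNp.le (by linarith [Real.pi_gt_three]))
    _ = ∫⁻ s in Ioc 0 (2 * Real.pi), ∫⁻ τ in Ioc 0 (2 * Real.pi),
          ENNReal.ofReal (|F s - F (s + τ)| / τ) :=
        (lintegral_lintegral_swap hmeas.aemeasurable).symm
    _ ≤ _ := by
        refine lintegral_mono fun s => ?_
        dsimp only
        have hper : Function.Periodic (fun t =>
            internalDist Y (φ (circleMap 0 1 s)) (φ (circleMap 0 1 t)) ^ (1 : ℝ) /
              edist (circleMap 0 1 s) (circleMap 0 1 t) ^ (1 : ℝ)) (2 * Real.pi) := fun t => by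
          simp only [periodic_circleMap 0 1 t]
        -- Periodicity allows the substitution `t = s + τ` over a full period.
        rw [← hper.setLIntegral_Ioc_comp_add_left Real.two_pi_pos s]
        refine setLIntegral_mono' measurableSet_Ioc fun τ hτ => ?_
        rw [ENNReal.rpow_one, ENNReal.rpow_one, ENNReal.ofReal_div_of_pos hτ.1]
        refine ENNReal.div_le_div ?_ (hedist s τ hτ.1.le)
        refine le_trans ?_ (edist_le_internalDist Y _ _)
        rw [edist_dist, dist_eq_norm, ← hφ, ← hφ]
        exact ENNReal.ofReal_le_ofReal (abs_norm_sub_norm_le _ _)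

/-! ### Fourier coefficients of the profile and divergence -/

theorem lacunaryProfile_circleMap (s : ℝ) : lacunaryProfile (circleMap 0 1 s)
    = 1 + ∑' n, (1 / 2 : ℝ) ^ n * (1 + Real.cos ((2 * lacunaryFreq n : ℕ) * s)) := by
  simp only [lacunaryProfile, discRetraction_of_norm_le (by simp : ‖circleMap 0 1 s‖ ≤ 1),
    radialWave_circleMap]

theorem lacunaryFreq_injective : Function.Injective lacunaryFreq :=
  (Nat.pow_right_injective le_rfl).comp (Nat.pow_right_injective (by norm_num : 2 ≤ 4))

theorem integral_lacunaryProfile_mul_cos (n : ℕ) (τ : ℝ) :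
    ∫ s in (0 : ℝ)..2 * Real.pi, lacunaryProfile (circleMap 0 1 (s + τ))
        * Real.cos ((2 * lacunaryFreq n : ℕ) * s)
      = Real.pi * (1 / 2) ^ n * Real.cos ((2 * lacunaryFreq n : ℕ) * τ) := by
  have hN : ∀ m, 2 * lacunaryFreq m ≠ 0 := fun m => by simp [lacunaryFreq]
  set N := 2 * lacunaryFreq n with hNdef
  have hcos : ∫ s in (0 : ℝ)..2 * Real.pi, Real.cos (N * s) = 0 := by
    simpa using integral_cos_int_mul_add (j := N) (by exact_mod_cast hN n) 0
  -- The summands have sup norm at most `2 · 2⁻ᵐ`, so the series integrates termwise; by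
  -- orthogonality only `m = n` survives.
  let c : ℕ → C(ℝ, ℝ) := fun m =>
    ⟨fun s => (1 / 2 : ℝ) ^ m * (1 + Real.cos ((2 * lacunaryFreq m : ℕ) * (s + τ)))
      * Real.cos (N * s), by fun_prop⟩
  have hc : ∀ m, ∫ s in (0 : ℝ)..2 * Real.pi, c m s
      = if m = n then Real.pi * (1 / 2) ^ n * Real.cos (N * τ) else 0 := by
    intro m
    have : ∀ s, c m s = (1 / 2 : ℝ) ^ m * (Real.cos (N * s)
        + Real.cos ((2 * lacunaryFreq m : ℕ) * (s + τ)) * Real.cos (N * s)) := fun s => by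
      simp only [c, ContinuousMap.coe_mk]
      ring
    simp_rw [this]
    rw [intervalIntegral.integral_const_mul, intervalIntegral.integral_add
      (Continuous.intervalIntegrable (by fun_prop) _ _)
      (Continuous.intervalIntegrable (by fun_prop) _ _), hcos, integral_cos_mul_cos (hN n),
      zero_add]
    have hiff : 2 * lacunaryFreq m = N ↔ m = n := by
      rw [hNdef, mul_right_inj' two_ne_zero, lacunaryFreq_injective.eq_iff]
    by_cases hmn : m = n
    · rw [if_pos hmn, if_pos (hiff.2 hmn), hmn]
      ring
    · rw [if_neg hmn, if_neg (mt hiff.1 hmn), mul_zero]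
  have hle : ∀ m s, ‖c m s‖ ≤ (1 / 2 : ℝ) ^ m * 2 := fun m s => by
    have h1 := Real.neg_one_le_cos ((2 * lacunaryFreq m : ℕ) * (s + τ))
    have h2 := Real.cos_le_one ((2 * lacunaryFreq m : ℕ) * (s + τ))
    simp only [c, ContinuousMap.coe_mk]
    rw [norm_mul, norm_mul, Real.norm_of_nonneg (by positivity : (0 : ℝ) ≤ (1 / 2) ^ m),
      Real.norm_of_nonneg (by linarith)]
    refine (mul_le_of_le_one_right (mul_nonneg (by positivity) (by linarith))
      (Real.abs_cos_le_one _)).trans ?_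
    gcongr
    linarith
  have hsum := intervalIntegral.tsum_intervalIntegral_eq_of_summable_norm (a := 0)
    (b := 2 * Real.pi) (f := c) <| (summable_geometric_two.mul_right 2).of_nonneg_of_le
      (fun _ => norm_nonneg _) fun m =>
        (ContinuousMap.norm_le _ (by positivity)).2 fun s => hle m s
  simp_rw [hc, tsum_ite_eq] at hsum
  have hcont : Continuous fun s => ∑' m, c m s :=
    continuous_tsum (fun m => (c m).continuous) (summable_geometric_two.mul_right 2) hle
  rw [hsum]
  have : ∀ s, lacunaryProfile (circleMap 0 1 (s + τ)) * Real.cos (N * s)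
      = Real.cos (N * s) + ∑' m, c m s := fun s => by
    rw [lacunaryProfile_circleMap, add_mul, one_mul, ← tsum_mul_right]
    rfl
  simp_rw [this]
  rw [intervalIntegral.integral_add (Continuous.intervalIntegrable (by fun_prop) _ _)
    (hcont.intervalIntegrable _ _), hcos, zero_add]

theorem not_internalDouglas_lacunary {Y : Set ℂ} {φ : ℂ → ℂ}
    (hφ : ∀ z, φ z = lacunaryProfile z • z) : ¬ InternalDouglas 1 Y φ := by
  intro h
  have hcont : Continuous fun s => lacunaryProfile (circleMap 0 1 s) :=
    continuous_lacunaryProfile.comp (continuous_circleMap 0 1)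
  have hnorm : ∀ s, ‖φ (circleMap 0 1 s)‖ = lacunaryProfile (circleMap 0 1 s) := fun s => by
    rw [hφ, norm_smul, Real.norm_of_nonneg (zero_le_one.trans (one_le_lacunaryProfile _))]
    simp
  have key := fun n : ℕ => ofReal_le_internalDouglas_integral (Y := Y) hcont hnorm
    (by positivity : 0 ≤ Real.pi * (1 / 2) ^ n)
    (by have : 0 < lacunaryFreq n := by simp [lacunaryFreq]
        omega : 1 ≤ 2 * lacunaryFreq n) (integral_lacunaryProfile_mul_cos n)
  have hlim : Tendsto (fun n : ℕ => Real.pi * (Real.log 2 * 2 ^ n - 1)) atTop atTop :=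
    (tendsto_atTop_add_const_right _ (-1) ((tendsto_pow_atTop_atTop_of_one_lt
      one_lt_two).const_mul_atTop (Real.log_pos one_lt_two))).const_mul_atTop Real.pi_pos
  refine h.not_ge ?_
  refine le_of_tendsto' (ENNReal.tendsto_ofReal_nhds_top.2 hlim) fun n => le_trans ?_ (key n)
  refine ENNReal.ofReal_le_ofReal ?_
  rw [mul_assoc]
  gcongr
  have hlog : (4 : ℝ) ^ n * Real.log 2 ≤ Real.log (2 * lacunaryFreq n : ℕ) := by
    have h4 : (4 : ℝ) ^ n * Real.log 2 = Real.log (lacunaryFreq n : ℕ) := by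
      rw [lacunaryFreq, Nat.cast_pow, Real.log_pow]
      norm_num
    rw [h4]
    have hpos : 0 < lacunaryFreq n := by simp [lacunaryFreq]
    exact Real.log_le_log (by exact_mod_cast hpos) (by exact_mod_cast by omega)
  -- The growth `4ⁿ` of `log N` beats the weight `2⁻ⁿ`, leaving `2ⁿ`.
  have h24 : (2 : ℝ) ^ n = (1 / 2) ^ n * 4 ^ n := by
    rw [← mul_pow]
    norm_num
  have h1 : (1 / 2 : ℝ) ^ n ≤ 1 := pow_le_one₀ (by norm_num) (by norm_num)
  calc Real.log 2 * 2 ^ n - 1 ≤ (1 / 2) ^ n * (4 ^ n * Real.log 2 - 1) := by rw [h24]; linarith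
    _ ≤ _ := by gcongr

/-! ### Conclusion -/

theorem MemSobolev.congr {p : ℝ≥0∞} {Ω : Set ℂ} (hΩ : MeasurableSet Ω) {f g : ℂ → ℂ}
    (hf : MemSobolev p Ω f) (hfg : EqOn f g Ω) : MemSobolev p Ω g := by
  obtain ⟨hLp, D, hD, hweak⟩ := hf
  refine ⟨hLp.ae_eq ((ae_restrict_mem hΩ).mono fun z hz => hfg hz), D, hD,
    fun η hη hc hsub v => ?_⟩
  rw [← hweak η hη hc hsub v]
  exact setIntegral_congr_fun hΩ fun z hz => by simp only [hfg hz]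

theorem theorem1p3 :
    ∃ (Y : Set ℂ) (h : ℂ → ℂ),
      IsJordanDomain Y ∧
      IsHomeomorphOn h (closedBall 0 1) (closure Y) ∧
      h '' sphere 0 1 = frontier Y ∧
      MemSobolev 1 (ball 0 1) h ∧
      ¬ InternalDouglas 1 Y h := by
  obtain ⟨e, he⟩ := exists_homeomorph_smul_of_radially_mono continuous_lacunaryProfile
    one_le_lacunaryProfile lacunaryProfile_smul_le
  refine ⟨e '' ball 0 1, e, e.isJordanDomain_image_ball, e.isHomeomorphOn_closedBall, ?_, ?_,
    not_internalDouglas_lacunary he⟩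
  · rw [← e.image_frontier, frontier_ball _ one_ne_zero]
  · refine memSobolev_lacunary.congr measurableSet_ball fun z hz => ?_
    rw [he]
    exact tsum_radialTerm (mem_ball_zero_iff.1 hz).le
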